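/- For each $n\ge 1$ let $x^{(n)}_1>x^{(n)}_2>\dots>x^{(n)}_n$ be integers. Let $\mu$ be a probability measure on $\mathbb R$ and let $a,b$ be reals with $b-a>1$, $\operatorname{Supp}(\mu)\subset[a,b]$ and $\{a,b\}\subset\operatorname{Supp}(\mu)$, and assume that $\frac1n\sum_{i=1}^n\delta_{x^{(n)}_i/n}\to\mu$ weakly as $n\to\infty$. Put $$C(w):=\int_a^b\frac{\mu[dx]}{w-x},\qquad f'_{(\chi,\eta)}(w):=C(w)+\log(w-\chi)-\log(w-\chi-\eta+1)\qquad(w\in\mathbb C\setminus\mathbb R),$$ where $\log$ is the principal logarithm, let $\mathbb H:=\{w\in\mathbb C:\operatorname{Im}w>0\}$, and let the liquid region $\mathcal L$ be the set of all $(\chi,\eta)\in[a,b]\times[0,1]$ with $b\ge\chi\ge\chi+\eta-1\ge a$ for which $f'_{(\chi,\eta)}$ has a non-real root. Then $\mathcal L$ is open in $\mathbb R^2$; for each $(\chi,\eta)\in\mathcal L$ the function $f'_{(\chi,\eta)}$ has exactly one root $W_{\mathcal L}(\chi,\eta)$ in $\mathbb H$; and the map $W_{\mathcal L}:\mathcal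 L\to\mathbb H$ is a $C^\infty$ diffeomorphism: it is a bijection, its inverse is $w\mapsto(\chi_{\mathcal L}(w),\eta_{\mathcal L}(w))$ with the real-valued functions $$\chi_{\mathcal L}(w)=w+\frac{(w-\bar w)(e^{C(\bar w)}-1)}{e^{C(w)}-e^{C(\bar w)}},\qquad \eta_{\mathcal L}(w)=1+\frac{(w-\bar w)(e^{C(w)}-1)(e^{C(\bar w)}-1)}{e^{C(w)}-e^{C(\bar w)}},$$ and both $W_{\mathcal L}\in C^\infty(\mathcal L,\mathbb H)$ and $(\chi_{\mathcal L},\eta_{\mathcal L})\in C^\infty(\mathbb H,\mathcal L)$ (smoothness in the sense of real variables, $\mathbb C=\mathbb R^2$). -/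

import Mathlib

open MeasureTheory Filter Topology
open scoped NNReal ContDiff

namespace GTLiquid

/-- The empirical measure `(1/n) ∑_i δ_{x_i / n}` of the rescaled positions `x_1, …, x_n`. -/
noncomputable def empirical {n : ℕ} (x : Fin n → ℤ) : FiniteMeasure ℝ :=
  (n : ℝ≥0)⁻¹ • ∑ i : Fin n, (diracProba ((x i : ℝ) / (n : ℝ))).toFiniteMeasure

/-- The standing hypothesis: the rows `x^{(n)}` consist of strictly decreasing integers, their
rescaled empirical measures converge weakly to the probability measure `μ`, and
`{a, b} ⊆ Supp μ ⊆ [a, b]` with `b - a > 1`. -/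
structure Hyp (x : (n : ℕ) → Fin n → ℤ) (μ : Measure ℝ) [IsProbabilityMeasure μ] (a b : ℝ) :
    Prop where
  anti : ∀ n, StrictAnti (x n)
  supp : μ.support ⊆ Set.Icc a b
  len : 1 < b - a
  left : a ∈ μ.support
  right : b ∈ μ.support
  conv : Tendsto (fun n => empirical (x n)) atTop (𝓝 (⟨μ, inferInstance⟩ : FiniteMeasure ℝ))

/-- The Cauchy transform `C(w) = ∫_a^b μ[dx] / (w - x)`. -/
noncomputable def C (μ : Measure ℝ) (a b : ℝ) (w : ℂ) : ℂ :=
  ∫ x in Set.Icc a b, 1 / (w - (x : ℂ)) ∂μ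

/-- The function `f'_{(χ,η)}(w) = C(w) + log (w - χ) - log (w - χ - η + 1)`, `p = (χ, η)`,
with the principal logarithm; it is only considered at non-real `w`. -/
noncomputable def fPrime (μ : Measure ℝ) (a b : ℝ) (p : ℝ × ℝ) (w : ℂ) : ℂ :=
  C μ a b w + Complex.log (w - (p.1 : ℂ)) - Complex.log (w - (p.1 : ℂ) - (p.2 : ℂ) + 1)

/-- The open upper half-plane, as a subset of `ℂ`. -/
def upperHalf : Set ℂ := {w | 0 < w.im}

/-- The asymptotic shape `{(χ, η) ∈ [a,b] × [0,1] : b ≥ χ ≥ χ + η - 1 ≥ a}`. -/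
def shape (a b : ℝ) : Set (ℝ × ℝ) :=
  {p | p.1 ∈ Set.Icc a b ∧ p.2 ∈ Set.Icc (0 : ℝ) 1 ∧
    p.1 ≤ b ∧ p.1 + p.2 - 1 ≤ p.1 ∧ a ≤ p.1 + p.2 - 1}

/-- The liquid region: the points of the shape for which `f'` has a non-real root. -/
def liquid (μ : Measure ℝ) (a b : ℝ) : Set (ℝ × ℝ) :=
  {p | p ∈ shape a b ∧ ∃ w : ℂ, w.im ≠ 0 ∧ fPrime μ a b p w = 0}

/-- The map `W_L` sending `(χ, η)` to the root of `f'` in the upper half-plane (its existence and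
uniqueness on the liquid region are part of the theorem; elsewhere the value is irrelevant). -/
noncomputable def W (μ : Measure ℝ) (a b : ℝ) (p : ℝ × ℝ) : ℂ :=
  Classical.epsilon fun w : ℂ => w ∈ upperHalf ∧ fPrime μ a b p w = 0

/-- The complex expression
`w + (w - w̄) (e^{C(w̄)} - 1) / (e^{C(w)} - e^{C(w̄)})` for `χ_L(w)`. -/
noncomputable def chiExpr (μ : Measure ℝ) (a b : ℝ) (w : ℂ) : ℂ :=
  w + (w - star w) * (Complex.exp (C μ a b (star w)) - 1) /
    (Complex.exp (C μ a b w) - Complex.exp (C μ a b (star w)))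

/-- The complex expression
`1 + (w - w̄) (e^{C(w)} - 1) (e^{C(w̄)} - 1) / (e^{C(w)} - e^{C(w̄)})` for `η_L(w)`. -/
noncomputable def etaExpr (μ : Measure ℝ) (a b : ℝ) (w : ℂ) : ℂ :=
  1 + (w - star w) * (Complex.exp (C μ a b w) - 1) * (Complex.exp (C μ a b (star w)) - 1) /
    (Complex.exp (C μ a b w) - Complex.exp (C μ a b (star w)))

/-- The map `w ↦ (χ_L(w), η_L(w))`. The two expressions are real on the upper half-plane (part of
the theorem), so that nothing is lost in taking real parts. -/
noncomputable def chiEta (μ : Measure ℝ) (a b : ℝ) (w : ℂ) : ℝ × ℝ :=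
  ((chiExpr μ a b w).re, (etaExpr μ a b w).re)

end GTLiquid

namespace GTLiquid

open Set Complex

/-! Distinct integers rescaled by `n` are at least `1/n` apart, so the limit satisfies `μ ≤ volume`.
Put `c = χ` and `d = χ + η - 1`. Then `f'` is the Cauchy transform of the signed measure `μ -
λ|_{[d, c]}` (`fPrime_eq`), which is nonpositive on `(d, c]` and nonnegative elsewhere. A test
function with the same sign pattern, such as `(x - d) (x - c)` over a positive weight, has
nonnegative integral, and the integral is positive as soon as `μ` is seen outside `[d, c]`. A root
of `f'` makes certain rational functions integrate to zero. Playing these two facts against each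
other confines `[d, c]` to `[a, b]` (`bounds_of_zero`) and excludes both a second root and a double
root in the upper half-plane (`signedInt_mul_ne_zero`).

For fixed `w`, exponentiating `f' = 0` gives `e^C (w - c) = w - d`, a real-linear system for `(c,
d)`. Domination by Lebesgue measure puts `Im C` in `(-π, 0)`. Hence `e^C` is not real, the system
has a unique solution, and no multiple of `2πi` is lost (`fPrime_eq_zero_iff`). So `chiEta` and `W`
are mutually inverse. A kernel vector of the derivative of `chiEta` would produce a double root, so
the inverse function theorem gives openness and smoothness. -/

/-! ### Domination of the limit measure by Lebesgue measure -/

/-- At most `n (t - s) + 1` of the points `x_i / n` lie in the interval `[s, t]`. -/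
theorem card_filter_div_mem_Icc_le {n : ℕ} (hn : 0 < n) {x : Fin n → ℤ}
    (hx : Function.Injective x) {s t : ℝ} (hst : s ≤ t) :
    ((Finset.univ.filter fun i => (x i : ℝ) / n ∈ Icc s t).card : ℝ) ≤ n * (t - s) + 1 := by
  have hn' : (0 : ℝ) < n := by exact_mod_cast hn
  have h1 : (Finset.univ.filter fun i => (x i : ℝ) / n ∈ Icc s t).card
      ≤ (Finset.Icc ⌈n * s⌉ ⌊n * t⌋).card := by
    refine Finset.card_le_card_of_injOn x (fun i hi => ?_) hx.injOn
    simp only [Finset.coe_filter, Finset.mem_univ, true_and, mem_ofPred_eq, mem_Icc] at hi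
    rw [le_div_iff₀ hn', div_le_iff₀ hn'] at hi
    simp only [Finset.coe_Icc, mem_Icc, Int.ceil_le, Int.le_floor]
    constructor <;> linarith [hi.1, hi.2]
  have h2 : (((⌊n * t⌋ + 1 - ⌈n * s⌉).toNat : ℤ) : ℝ) ≤ n * (t - s) + 1 := by
    have h3 : ((⌊n * t⌋ + 1 - ⌈n * s⌉ : ℤ) : ℝ) ≤ n * (t - s) + 1 := by
      push_cast
      linarith [Int.floor_le (n * t), Int.le_ceil (n * s)]
    have h4 : (0 : ℝ) ≤ n * (t - s) + 1 := by nlinarith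
    rw [Int.toNat_eq_max, Int.cast_max]
    exact max_le h3 (by simpa using h4)
  rw [Int.card_Icc] at h1
  refine le_trans ?_ h2
  exact_mod_cast h1

theorem empirical_Icc_le {n : ℕ} (hn : 0 < n) {x : Fin n → ℤ}
    (hx : Function.Injective x) {s t : ℝ} (hst : s ≤ t) :
    (empirical x : Measure ℝ) (Icc s t) ≤ ENNReal.ofReal (t - s + 1 / n) := by
  have hn' : (0 : ℝ) < n := by exact_mod_cast hn
  have key : (empirical x : Measure ℝ) (Icc s t) = ENNReal.ofReal
      ((n : ℝ)⁻¹ * ((Finset.univ.filter fun i => (x i : ℝ) / n ∈ Icc s t).card : ℝ)) := by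
    rw [empirical, FiniteMeasure.toMeasure_smul, FiniteMeasure.toMeasure_sum]
    simp only [Measure.smul_apply, Measure.finsetSum_apply]
    have h1 : ∀ i, ((diracProba ((x i : ℝ) / (n : ℝ))).toFiniteMeasure : Measure ℝ) (Icc s t)
        = if (x i : ℝ) / n ∈ Icc s t then 1 else 0 := by
      intro i
      change Measure.dirac ((x i : ℝ) / (n : ℝ)) (Icc s t) = _
      rw [Measure.dirac_apply' _ measurableSet_Icc, indicator_apply]
      rfl
    simp only [h1, Finset.sum_boole]
    rw [ENNReal.ofReal_mul (by positivity), ENNReal.ofReal_natCast, ENNReal.smul_def,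
      smul_eq_mul]
    congr 1
    rw [← ENNReal.ofReal_coe_nnreal]
    simp
  rw [key]
  refine ENNReal.ofReal_le_ofReal ?_
  calc _ ≤ (n : ℝ)⁻¹ * (n * (t - s) + 1) :=
        mul_le_mul_of_nonneg_left (card_filter_div_mem_Icc_le hn hx hst) (by positivity)
    _ = _ := by field_simp

theorem empirical_univ {n : ℕ} (hn : 0 < n) (x : Fin n → ℤ) :
    (empirical x : Measure ℝ) univ = 1 := by
  have h1 : ∀ i, ((diracProba ((x i : ℝ) / (n : ℝ))).toFiniteMeasure : Measure ℝ) univ = 1 :=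
    fun i => measure_univ (μ := Measure.dirac ((x i : ℝ) / (n : ℝ)))
  rw [empirical, FiniteMeasure.toMeasure_smul, FiniteMeasure.toMeasure_sum]
  simp only [Measure.smul_apply, Measure.finsetSum_apply, h1, Finset.sum_const, Finset.card_univ,
    Fintype.card_fin, nsmul_eq_mul, mul_one]
  rw [ENNReal.smul_def, smul_eq_mul, ENNReal.coe_inv (by exact_mod_cast hn.ne'),
    ENNReal.coe_natCast]
  exact ENNReal.inv_mul_cancel (by exact_mod_cast hn.ne') (ENNReal.natCast_ne_top n)

/-- Portmanteau on the closed complement: the empirical measures give it at least `1 - (t - s) -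
1/n`, and the limsup inequality passes this lower bound to `μ`. -/
theorem Hyp.measure_Ioo_le {x : (n : ℕ) → Fin n → ℤ} {μ : Measure ℝ} [IsProbabilityMeasure μ]
    {a b : ℝ} (h : Hyp x μ a b) {s t : ℝ} (hst : s ≤ t) :
    μ (Ioo s t) ≤ ENNReal.ofReal (t - s) := by
  have h1 := FiniteMeasure.limsup_measure_closed_le_of_tendsto h.conv
    (isOpen_Ioo.isClosed_compl : IsClosed (Ioo s t)ᶜ)
  simp only [FiniteMeasure.toMeasure_mk] at h1
  have h2 : 1 ≤ μ (Ioo s t)ᶜ + ENNReal.ofReal (t - s) := by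
    refine ENNReal.le_of_forall_pos_le_add fun ε hε _ => ?_
    have h3 : limsup (fun n => (empirical (x n) : Measure ℝ) (Ioo s t)ᶜ) atTop
        < μ (Ioo s t)ᶜ + ε :=
      h1.trans_lt (ENNReal.lt_add_right (measure_ne_top _ _) (by exact_mod_cast hε.ne'))
    have h4 := eventually_lt_of_limsup_lt h3
    have h5 : ∀ᶠ n : ℕ in atTop,
        1 ≤ μ (Ioo s t)ᶜ + ε + ENNReal.ofReal (t - s + 1 / n) := by
      filter_upwards [h4, eventually_gt_atTop 0] with n hn hn0
      calc (1 : ENNReal) = (empirical (x n) : Measure ℝ) univ := (empirical_univ hn0 _).symm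
        _ ≤ (empirical (x n) : Measure ℝ) ((Ioo s t)ᶜ ∪ Icc s t) := by
          refine measure_mono fun y _ => ?_
          by_cases hy : y ∈ Ioo s t
          · exact Or.inr (Ioo_subset_Icc_self hy)
          · exact Or.inl hy
        _ ≤ _ := measure_union_le _ _
        _ ≤ _ := add_le_add hn.le (empirical_Icc_le hn0 (h.anti n).injective hst)
    have h6 : Tendsto (fun n : ℕ => μ (Ioo s t)ᶜ + ε + ENNReal.ofReal (t - s + 1 / n)) atTop
        (𝓝 (μ (Ioo s t)ᶜ + ε + ENNReal.ofReal (t - s + 0))) :=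
      tendsto_const_nhds.add (ENNReal.tendsto_ofReal
        (tendsto_const_nhds.add tendsto_one_div_atTop_nhds_zero_nat))
    have h7 := ge_of_tendsto h6 h5
    rwa [add_zero, add_right_comm] at h7
  have h3 : μ (Ioo s t) + μ (Ioo s t)ᶜ = 1 := by
    rw [measure_add_measure_compl measurableSet_Ioo, measure_univ]
  rw [← h3, add_comm] at h2
  exact (ENNReal.add_le_add_iff_left (measure_ne_top _ _)).1 h2

/-- A measure on the line giving each interval at most its length is at most Lebesgue measure. -/
theorem le_volume_of_Ioc_le {μ : Measure ℝ}
    (h : ∀ s t : ℝ, μ (Ioc s t) ≤ ENNReal.ofReal (t - s)) : μ ≤ volume := by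
  have h1 : μ.toOuterMeasure ≤ StieltjesFunction.id.outer := by
    refine OuterMeasure.le_ofFunction.2 fun s => ?_
    rw [StieltjesFunction.length_eq]
    refine le_iInf fun p => le_iInf fun q => le_iInf fun hs => ?_
    -- The line has no least point, so a cover by half-open intervals needs no extra bottom element.
    rw [show (botSet : Set ℝ) = ∅ from eq_empty_of_forall_notMem not_isBot, sdiff_empty] at hs
    exact (measure_mono hs).trans (h p q)
  rw [Real.volume_eq_stieltjes_id, StieltjesFunction.measure]
  exact Measure.le_iff.2 fun s hs => h1 s

theorem Hyp.le_volume {x : (n : ℕ) → Fin n → ℤ} {μ : Measure ℝ} [IsProbabilityMeasure μ]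
    {a b : ℝ} (h : Hyp x μ a b) : μ ≤ volume := by
  refine le_volume_of_Ioc_le fun s t => ?_
  rcases le_or_gt t s with hts | hst
  · simp [Ioc_eq_empty (not_lt.2 hts)]
  have h1 : ∀ᶠ ε : ℝ in 𝓝[>] 0, μ (Ioc s t) ≤ ENNReal.ofReal (t + ε - s) := by
    filter_upwards [self_mem_nhdsWithin] with ε hε
    have hε : 0 < ε := hε
    refine le_trans (measure_mono fun y hy => ?_) (h.measure_Ioo_le (by linarith))
    exact ⟨hy.1, by linarith [hy.2]⟩
  have h2 : Tendsto (fun ε : ℝ => ENNReal.ofReal (t + ε - s)) (𝓝[>] 0)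
      (𝓝 (ENNReal.ofReal (t + 0 - s))) :=
    ENNReal.tendsto_ofReal ((((continuous_const.add continuous_id).sub
      continuous_const).tendsto 0).mono_left nhdsWithin_le_nhds)
  simpa using ge_of_tendsto h2 h1

/-- A measure carried by `[a, b]`, with `a` and `b` in its support, that is dominated by
Lebesgue measure. -/
structure IsDominated (μ : Measure ℝ) (a b : ℝ) : Prop where
  le_volume : μ ≤ volume
  compl_null : μ (Icc a b)ᶜ = 0
  len : 1 < b - a
  left : a ∈ μ.support
  right : b ∈ μ.support

theorem Hyp.isDominated {x : (n : ℕ) → Fin n → ℤ} {μ : Measure ℝ} [IsProbabilityMeasure μ]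
    {a b : ℝ} (h : Hyp x μ a b) : IsDominated μ a b where
  le_volume := h.le_volume
  compl_null := measure_mono_null (compl_subset_compl.2 h.supp) Measure.measure_compl_support
  len := h.len
  left := h.left
  right := h.right

variable {μ : Measure ℝ} {a b : ℝ}

theorem IsDominated.restrict_eq (h : IsDominated μ a b) : μ.restrict (Icc a b) = μ :=
  Measure.restrict_eq_self_of_ae_mem h.compl_null

theorem IsDominated.integrable [IsProbabilityMeasure μ] {E : Type*} [NormedAddCommGroup E] (h : IsDominated μ a b)
    {g : ℝ → E} (hg : Continuous g) : Integrable g μ := by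
  have := hg.continuousOn.integrableOn_Icc (μ := μ) (a := a) (b := b)
  rwa [IntegrableOn, h.restrict_eq] at this

/-! ### Sign arguments for the signed measure -/

section signedInt

variable {E : Type*} [NormedAddCommGroup E] [NormedSpace ℝ E]

/-- The integral against the signed measure `μ - λ|_{[d, c]}`, where `λ` is Lebesgue measure. -/
noncomputable def signedInt (μ : Measure ℝ) (d c : ℝ) (g : ℝ → E) : E :=
  ∫ x, g x ∂μ - ∫ x in d..c, g x

theorem IsDominated.signedInt_add [IsProbabilityMeasure μ] (h : IsDominated μ a b) (d c : ℝ) {f g : ℝ → E}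
    (hf : Continuous f) (hg : Continuous g) :
    signedInt μ d c (fun x => f x + g x) = signedInt μ d c f + signedInt μ d c g := by
  rw [signedInt, integral_add (h.integrable hf) (h.integrable hg),
    intervalIntegral.integral_add (hf.intervalIntegrable _ _) (hg.intervalIntegrable _ _),
    signedInt, signedInt]
  abel

theorem signedInt_const_mul {d c : ℝ} {𝕜 : Type*} [RCLike 𝕜] (k : 𝕜) (f : ℝ → 𝕜) :
    signedInt μ d c (fun x => k * f x) = k * signedInt μ d c f := by
  rw [signedInt, integral_const_mul, intervalIntegral.integral_const_mul, signedInt, mul_sub]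

theorem signedInt_conj {d c : ℝ} (f : ℝ → ℂ) :
    signedInt μ d c (fun x => star (f x)) = star (signedInt μ d c f) := by
  have h1 : ∫ x, star (f x) ∂μ = star (∫ x, f x ∂μ) := integral_conj
  have h2 : ∫ x in d..c, star (f x) = star (∫ x in d..c, f x) :=
    intervalIntegral.intervalIntegral_conj
  rw [signedInt, h1, h2, signedInt, star_sub]

theorem signedInt_ofReal {d c : ℝ} (f : ℝ → ℝ) :
    signedInt μ d c (fun x => (f x : ℂ)) = ((signedInt μ d c f : ℝ) : ℂ) := by
  have h1 : ∫ x, (f x : ℂ) ∂μ = ((∫ x, f x ∂μ : ℝ) : ℂ) := integral_ofReal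
  rw [signedInt, h1, intervalIntegral.integral_ofReal, signedInt, ofReal_sub]

theorem IsDominated.signedInt_eq [IsProbabilityMeasure μ] (h : IsDominated μ a b) {d c : ℝ} (hdc : d ≤ c) {g : ℝ → ℝ}
    (hg : Continuous g) :
    signedInt μ d c g = ∫ x in (Ioc d c)ᶜ, g x ∂μ +
      ((∫ x in Ioc d c, -g x) - ∫ x in Ioc d c, -g x ∂μ) := by
  rw [signedInt, intervalIntegral.integral_of_le hdc,
    ← integral_add_compl (measurableSet_Ioc (a := d) (b := c)) (h.integrable hg), integral_neg,
    integral_neg]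
  ring

/-- On `(d, c]` both `g` and `μ - λ` are nonpositive, so that part of the integral is nonnegative
and can be dropped. -/
theorem IsDominated.compl_Ioc_le_signedInt [IsProbabilityMeasure μ] (h : IsDominated μ a b) {d c : ℝ} (hdc : d ≤ c)
    {g : ℝ → ℝ} (hg : Continuous g) (hneg : ∀ x ∈ Ioc d c, g x ≤ 0) :
    ∫ x in (Ioc d c)ᶜ, g x ∂μ ≤ signedInt μ d c g := by
  have h2 : ∫ x in Ioc d c, -g x ∂μ ≤ ∫ x in Ioc d c, -g x := by
    refine integral_mono_measure (Measure.restrict_mono le_rfl h.le_volume) ?_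
      ((hg.neg.integrableOn_Icc).mono_set Ioc_subset_Icc_self)
    filter_upwards [ae_restrict_mem measurableSet_Ioc] with x hx
    simpa using hneg x hx
  rw [h.signedInt_eq hdc hg]
  linarith

theorem IsDominated.nonneg_compl_Ioc (h : IsDominated μ a b) {d c : ℝ} {g : ℝ → ℝ}
    (hpos : ∀ x ∈ Icc a b, x ∉ Ioc d c → 0 ≤ g x) : 0 ≤ᵐ[μ.restrict (Ioc d c)ᶜ] g := by
  have h1 : ∀ᵐ x ∂μ, x ∈ Icc a b := h.compl_null
  filter_upwards [ae_restrict_mem measurableSet_Ioc.compl, ae_restrict_of_ae h1] with x hx hx'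
  exact hpos x hx' hx

theorem IsDominated.signedInt_nonneg [IsProbabilityMeasure μ] (h : IsDominated μ a b) {d c : ℝ} (hdc : d ≤ c) {g : ℝ → ℝ}
    (hg : Continuous g) (hneg : ∀ x ∈ Ioc d c, g x ≤ 0)
    (hpos : ∀ x ∈ Icc a b, x ∉ Ioc d c → 0 ≤ g x) : 0 ≤ signedInt μ d c g :=
  (integral_nonneg_of_ae (h.nonneg_compl_Ioc hpos)).trans (h.compl_Ioc_le_signedInt hdc hg hneg)

/-- Strictness comes from a neighbourhood of `y` that avoids `[d, c]`, on which `g > 0` and `μ` has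
mass. The closed interval is excluded so that such a neighbourhood exists. -/
theorem IsDominated.signedInt_pos [IsProbabilityMeasure μ] (h : IsDominated μ a b) {d c : ℝ} (hdc : d ≤ c) {g : ℝ → ℝ}
    (hg : Continuous g) (hneg : ∀ x ∈ Ioc d c, g x ≤ 0)
    (hpos : ∀ x ∈ Icc a b, x ∉ Ioc d c → 0 ≤ g x) {y : ℝ} (hy : y ∈ μ.support)
    (hyd : y ∉ Icc d c) (hgy : 0 < g y) : 0 < signedInt μ d c g := by
  refine lt_of_lt_of_le ?_ (h.compl_Ioc_le_signedInt hdc hg hneg)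
  rw [integral_pos_iff_support_of_nonneg_ae (h.nonneg_compl_Ioc hpos)
    (h.integrable hg).integrableOn]
  have hU : IsOpen ((Icc d c)ᶜ ∩ {x | 0 < g x}) :=
    isClosed_Icc.isOpen_compl.inter (isOpen_lt continuous_const hg)
  have h1 : 0 < μ ((Icc d c)ᶜ ∩ {x | 0 < g x}) :=
    (Measure.mem_support_iff_forall y).1 hy _ (hU.mem_nhds ⟨hyd, hgy⟩)
  rw [Measure.restrict_apply' measurableSet_Ioc.compl]
  refine h1.trans_le (measure_mono fun x hx => ⟨ne_of_gt hx.2, fun hx' => hx.1 ?_⟩)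
  exact Ioc_subset_Icc_self hx'

/-- The support points `a` and `b` are more than `1` apart, so they cannot both lie in `[d, c]`. -/
theorem IsDominated.exists_support_notMem (h : IsDominated μ a b) {d c : ℝ} (hcd : c - d ≤ 1) :
    ∃ y ∈ μ.support, y ∉ Icc d c := by
  by_cases ha : a ∈ Icc d c
  · exact ⟨b, h.right, fun hb => by linarith [h.len, ha.1, hb.2]⟩
  · exact ⟨a, h.left, ha⟩

theorem signedInt_one [IsProbabilityMeasure μ] {d c : ℝ} : signedInt μ d c (fun _ => (1 : ℝ)) = 1 - (c - d) := by
  simp [signedInt]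

end signedInt

/-! ### Resolvents and the range of the Cauchy transform -/

theorem sub_ofReal_ne_zero {w : ℂ} (hw : w.im ≠ 0) (x : ℝ) : w - x ≠ 0 := fun h => hw (by
  simpa using congrArg Complex.im h)

theorem sub_ofReal_mem_slitPlane {w : ℂ} (hw : w.im ≠ 0) (x : ℝ) : w - x ∈ slitPlane :=
  Or.inr (by simpa using hw)

theorem continuous_resolvent {w : ℂ} (hw : w.im ≠ 0) : Continuous fun x : ℝ => 1 / (w - x) :=
  continuous_const.div (by fun_prop) (sub_ofReal_ne_zero hw)

theorem integral_resolvent {w : ℂ} (hw : w.im ≠ 0) (d c : ℝ) :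
    ∫ x in d..c, 1 / (w - (x : ℂ)) = log (w - d) - log (w - c) := by
  have h1 : ∀ x ∈ uIcc d c, HasDerivAt (fun x : ℝ => -log (w - x)) (1 / (w - (x : ℂ))) x := by
    intro x _
    have h2 : HasDerivAt (fun x : ℝ => w - (x : ℂ)) (-1) x := by
      simpa using (hasDerivAt_id x).ofReal_comp.const_sub w
    have h3 := (h2.clog_real (sub_ofReal_mem_slitPlane hw x)).neg
    exact h3.congr_deriv (by ring)
  rw [intervalIntegral.integral_eq_sub_of_hasDerivAt h1
    ((continuous_resolvent hw).intervalIntegrable _ _)]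
  ring

theorem IsDominated.C_eq (h : IsDominated μ a b) (w : ℂ) :
    C μ a b w = ∫ x, 1 / (w - (x : ℂ)) ∂μ := by
  rw [C, h.restrict_eq]

/-- The principal logarithm is a primitive along the whole segment, since `w - x` never meets the
real axis. The oriented integral makes this valid without `d ≤ c`. -/
theorem IsDominated.fPrime_eq [IsProbabilityMeasure μ] (h : IsDominated μ a b) (p : ℝ × ℝ) {w : ℂ} (hw : w.im ≠ 0) :
    fPrime μ a b p w = signedInt μ (p.1 + p.2 - 1) p.1 fun x => 1 / (w - (x : ℂ)) := by
  rw [fPrime, h.C_eq, signedInt, integral_resolvent hw]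
  push_cast
  rw [show w - (p.1 : ℂ) - p.2 + 1 = w - (p.1 + p.2 - 1) by ring]
  ring

theorem IsDominated.C_star (h : IsDominated μ a b) (w : ℂ) :
    C μ a b (star w) = star (C μ a b w) := by
  rw [h.C_eq, h.C_eq]
  have : star (∫ x, 1 / (w - (x : ℂ)) ∂μ) = ∫ x, star (1 / (w - (x : ℂ))) ∂μ :=
    integral_conj.symm
  rw [this]
  simp

theorem IsDominated.im_C [IsProbabilityMeasure μ] (h : IsDominated μ a b) {w : ℂ} (hw : w.im ≠ 0) :
    (C μ a b w).im = ∫ x, (1 / (w - (x : ℂ))).im ∂μ := by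
  rw [h.C_eq]
  exact (integral_im (h.integrable (continuous_resolvent hw))).symm

theorem im_resolvent (w : ℂ) (x : ℝ) : (1 / (w - (x : ℂ))).im = -w.im / normSq (w - x) := by
  simp

theorem im_resolvent_neg {w : ℂ} (hw : 0 < w.im) (x : ℝ) : (1 / (w - (x : ℂ))).im < 0 := by
  rw [im_resolvent]
  exact div_neg_of_neg_of_pos (by linarith) (normSq_pos.2 (sub_ofReal_ne_zero hw.ne' x))

theorem IsDominated.im_C_neg [IsProbabilityMeasure μ] (h : IsDominated μ a b) {w : ℂ} (hw : 0 < w.im) :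
    (C μ a b w).im < 0 := by
  rw [h.im_C hw.ne']
  have hc := continuous_im.comp (continuous_resolvent hw.ne')
  have h1 : 0 < ∫ x, -(1 / (w - (x : ℂ))).im ∂μ := by
    rw [integral_pos_iff_support_of_nonneg]
    · rw [show (Function.support fun x : ℝ => -(1 / (w - (x : ℂ))).im) = univ from
        eq_univ_of_forall fun x => (neg_pos.2 (im_resolvent_neg hw x)).ne']
      simp
    · exact fun x => (neg_pos.2 (im_resolvent_neg hw x)).le
    · exact h.integrable hc.neg
  rw [integral_neg] at h1
  linarith

/-- Replacing `μ` by Lebesgue measure on `[a, b]` can only increase `-Im C`, and there it equals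
`arg (w - b) - arg (w - a) < π`. -/
theorem IsDominated.neg_pi_lt_im_C [IsProbabilityMeasure μ] (h : IsDominated μ a b) {w : ℂ} (hw : 0 < w.im) :
    -Real.pi < (C μ a b w).im := by
  have hab : a ≤ b := by linarith [h.len]
  rw [h.im_C hw.ne']
  have hc : Continuous fun x : ℝ => (1 / (w - (x : ℂ))).im :=
    continuous_im.comp (continuous_resolvent hw.ne')
  have h1 : ∫ x, -(1 / (w - (x : ℂ))).im ∂μ ≤ ∫ x in Icc a b, -(1 / (w - (x : ℂ))).im := by
    rw [← h.restrict_eq]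
    refine integral_mono_measure (Measure.restrict_mono le_rfl h.le_volume)
      (ae_of_all _ fun x => (neg_pos.2 (im_resolvent_neg hw x)).le) hc.neg.integrableOn_Icc
  have h2 : ∫ x in Icc a b, (1 / (w - (x : ℂ))).im = (log (w - a) - log (w - b)).im := by
    rw [integral_Icc_eq_integral_Ioc, ← integral_resolvent hw.ne',
      intervalIntegral.integral_of_le hab]
    exact integral_im (((continuous_resolvent hw.ne').integrableOn_Icc).mono_set
      Ioc_subset_Icc_self)
  rw [integral_neg, integral_neg, h2, sub_im, log_im, log_im] at h1
  have h3 : 0 < arg (w - a) := by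
    rcases (arg_nonneg_iff.2 (by simpa using hw.le : 0 ≤ (w - a).im)).lt_or_eq with h4 | h4
    · exact h4
    · exact absurd (arg_eq_zero_iff.1 h4.symm).2 (by simpa using hw.ne')
  have h4 : arg (w - b) < Real.pi := arg_lt_pi_iff.2 (Or.inr (by simpa using hw.ne'))
  linarith

/-! ### Zeros of the Cauchy transform of the signed measure -/

/-- Partial fractions of `(x - d) (x - c) / ((w - x) (v - x) (w' - x) (v' - x))`, in a form that
stays meaningful for `v = w`. -/
theorem partial_fractions {K : Type*} [Field K] {w v w' v' x : K} (d c : K)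
    (h1 : w - w' ≠ 0) (h2 : w - v' ≠ 0) (h3 : v - w' ≠ 0) (h4 : v - v' ≠ 0)
    (hw : w - x ≠ 0) (hv : v - x ≠ 0) (hw' : w' - x ≠ 0) (hv' : v' - x ≠ 0) :
    (x - d) * (x - c) / (((w - x) * (w' - x)) * ((v - x) * (v' - x))) =
      ((w - d) * (w - c) / ((w - w') * (w - v')) * (1 / ((w - x) * (v - x))) +
        -((v * w * (d + c - (w' + v')) + (w' * v' - d * c) * (v + w) +
          (d * c * (w' + v') - (d + c) * (w' * v'))) /
          ((w - w') * (w - v') * ((v - w') * (v - v')))) * (1 / (v - x))) +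
      ((w' - d) * (w' - c) / ((w' - w) * (w' - v)) * (1 / ((w' - x) * (v' - x))) +
        -((v' * w' * (d + c - (w + v)) + (w * v - d * c) * (v' + w') +
          (d * c * (w + v) - (d + c) * (w * v))) /
          ((w' - w) * (w' - v) * ((v' - w) * (v' - v)))) * (1 / (v' - x))) := by
  rw [← neg_sub w w', ← neg_sub v w', ← neg_sub w v', ← neg_sub v v']
  field_simp
  ring

theorem IsDominated.signedInt_linear_combination [IsProbabilityMeasure μ] (h : IsDominated μ a b)
    (d c : ℝ) {𝕜 : Type*} [RCLike 𝕜] (k l : 𝕜) {f g : ℝ → 𝕜} (hf : Continuous f)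
    (hg : Continuous g) : signedInt μ d c (fun x => k * f x + l * g x) =
      k * signedInt μ d c f + l * signedInt μ d c g := by
  rw [h.signedInt_add d c (hf.const_mul k) (hg.const_mul l), signedInt_const_mul,
    signedInt_const_mul]

theorem IsDominated.signedInt_re [IsProbabilityMeasure μ] (h : IsDominated μ a b) {d c : ℝ}
    {f : ℝ → ℂ} (hf : Continuous f) :
    signedInt μ d c (fun x => (f x).re) = (signedInt μ d c f).re := by
  have h1 : signedInt μ d c (fun x => f x + star (f x)) =
      signedInt μ d c f + star (signedInt μ d c f) := by
    rw [h.signedInt_add d c hf hf.star, signedInt_conj]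
  have h2 : (fun x => f x + star (f x)) = fun x => (2 : ℂ) * (((f x).re : ℝ) : ℂ) := by
    funext x
    apply Complex.ext <;> simp [two_mul]
  rw [h2, signedInt_const_mul, signedInt_ofReal] at h1
  have h3 := congrArg Complex.re h1
  simp only [mul_re, re_ofNat, ofReal_re, im_ofNat, ofReal_im, add_re, star_def, conj_re] at h3
  linarith

theorem continuous_resolvent_mul {w v : ℂ} (hw : w.im ≠ 0) (hv : v.im ≠ 0) :
    Continuous fun x : ℝ => 1 / ((w - x) * (v - x)) :=
  continuous_const.div (by fun_prop)
    fun x => mul_ne_zero (sub_ofReal_ne_zero hw x) (sub_ofReal_ne_zero hv x)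

theorem continuous_div_normSq {w : ℂ} (hw : w.im ≠ 0) {g : ℝ → ℝ} (hg : Continuous g) :
    Continuous fun x : ℝ => g x / normSq (w - x) :=
  hg.div (continuous_normSq.comp (by fun_prop))
    fun x => (normSq_pos.2 (sub_ofReal_ne_zero hw x)).ne'

/-- Real parts of complex multiples of `1 / (w - x)` are exactly the functions (linear) / `|w -
x|²`, because `Im w ≠ 0`. -/
theorem IsDominated.signedInt_linear_div [IsProbabilityMeasure μ] (h : IsDominated μ a b)
    {d c : ℝ} {w : ℂ} (hw : w.im ≠ 0)
    (h0 : signedInt μ d c (fun x => 1 / (w - (x : ℂ))) = 0) (α β : ℝ) :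
    signedInt μ d c (fun x => (α + β * x) / normSq (w - x)) = 0 := by
  have h1 : (fun x : ℝ => (α + β * x) / normSq (w - x)) =
      fun x : ℝ => ((-β + ((α + β * w.re) / w.im) * I) * (1 / (w - (x : ℂ)))).re := by
    funext x
    have := (normSq_pos.2 (sub_ofReal_ne_zero hw x)).ne'
    simp
    field_simp
    ring
  rw [h1, h.signedInt_re ((continuous_resolvent hw).const_mul _), signedInt_const_mul,
    h0, mul_zero, zero_re]

/-- If the Cauchy transform of `μ - λ|_{[d, c]}` has a non-real zero, then `[d, c]` is a
subinterval of `[a, b]` of length at most `1`. -/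
theorem IsDominated.bounds_of_zero [IsProbabilityMeasure μ] (h : IsDominated μ a b)
    {d c : ℝ} (hdc : d ≤ c) {w : ℂ} (hw : w.im ≠ 0)
    (h0 : signedInt μ d c (fun x => 1 / (w - (x : ℂ))) = 0) :
    c - d ≤ 1 ∧ a ≤ d ∧ c ≤ b := by
  have hN : ∀ x : ℝ, 0 < normSq (w - x) := fun x => normSq_pos.2 (sub_ofReal_ne_zero hw x)
  have hcd : c - d ≤ 1 := by
    have h1 : 0 ≤ signedInt μ d c (fun x => (x - d) * (x - c) / normSq (w - x)) := by
      refine h.signedInt_nonneg hdc (continuous_div_normSq hw (by fun_prop)) ?_ ?_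
      · exact fun x hx => div_nonpos_of_nonpos_of_nonneg
          (mul_nonpos_of_nonneg_of_nonpos (by linarith [hx.1]) (by linarith [hx.2])) (hN x).le
      · intro x _ hx
        refine div_nonneg ?_ (hN x).le
        rcases le_or_gt x d with h2 | h2
        · exact mul_nonneg_of_nonpos_of_nonpos (by linarith) (by linarith)
        · have h3 : c < x := not_le.1 fun h3 => hx ⟨h2, h3⟩
          exact mul_nonneg (by linarith) (by linarith)
    -- Division with remainder: the quotient `1` integrates to `1 - (c - d)`, and the linear
    -- remainder integrates to zero.
    have h2 : (fun x : ℝ => (x - d) * (x - c) / normSq (w - x)) = fun x : ℝ =>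
        1 + ((d * c - normSq w) + (2 * w.re - d - c) * x) / normSq (w - x) := by
      funext x
      have hx : normSq (w - x) = normSq w - 2 * w.re * x + x ^ 2 := by
        simp [normSq_apply]
        ring
      rw [← sub_eq_iff_eq_add', eq_div_iff (hN x).ne', sub_mul, div_mul_cancel₀ _ (hN x).ne', hx]
      ring
    rw [h2, h.signedInt_add d c continuous_const (continuous_div_normSq hw (by fun_prop)),
      h.signedInt_linear_div hw h0, signedInt_one] at h1
    linarith
  have hlen := h.len
  refine ⟨hcd, ?_, ?_⟩
  · by_contra! hda
    have hcb : c < b := by linarith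
    -- With `d < a`, every point of `[a, b]` outside `(d, c]` lies to the right of `c`, so `x - c`
    -- already has the required signs.
    have h1 : 0 < signedInt μ d c (fun x => (-c + 1 * x) / normSq (w - x)) := by
      refine h.signedInt_pos hdc (continuous_div_normSq hw (by fun_prop)) ?_ ?_ h.right
        (fun hb => by linarith [hb.2]) (div_pos (by linarith) (hN b))
      · exact fun x hx => div_nonpos_of_nonpos_of_nonneg (by linarith [hx.2]) (hN x).le
      · intro x hx hx'
        have h3 : c < x := not_le.1 fun h3 => hx' ⟨hda.trans_le hx.1, h3⟩
        exact div_nonneg (by linarith) (hN x).le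
    exact h1.ne' (h.signedInt_linear_div hw h0 _ _)
  · by_contra! hbc
    have hda : a < d := by linarith
    have h1 : 0 < signedInt μ d c (fun x => (d + -1 * x) / normSq (w - x)) := by
      refine h.signedInt_pos hdc (continuous_div_normSq hw (by fun_prop)) ?_ ?_ h.left
        (fun hb => by linarith [hb.1]) (div_pos (by linarith) (hN a))
      · exact fun x hx => div_nonpos_of_nonpos_of_nonneg (by linarith [hx.1]) (hN x).le
      · intro x hx hx'
        have h3 : x ≤ d := not_lt.1 fun h3 => hx' ⟨h3, hx.2.trans hbc.le⟩
        exact div_nonneg (by linarith) (hN x).le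
    exact h1.ne' (h.signedInt_linear_div hw h0 _ _)

/-- The Cauchy transform of `μ - λ|_{[d, c]}` has at most one zero in the upper half-plane, counted
with multiplicity: for zeros `w ≠ v` the integral of `1 / ((w - x) (v - x))` vanishes, and for a
double zero `w = v` it does as well. -/
theorem IsDominated.signedInt_mul_ne_zero [IsProbabilityMeasure μ] (h : IsDominated μ a b)
    {d c : ℝ} (hdc : d ≤ c) (hcd : c - d ≤ 1) {w v : ℂ} (hw : 0 < w.im) (hv : 0 < v.im)
    (h0 : signedInt μ d c (fun x => 1 / (v - (x : ℂ))) = 0) :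
    signedInt μ d c (fun x => 1 / ((w - (x : ℂ)) * (v - x))) ≠ 0 := by
  intro h1
  have hN : ∀ x : ℝ, 0 < normSq (w - x) * normSq (v - x) := fun x => mul_pos
    (normSq_pos.2 (sub_ofReal_ne_zero hw.ne' x)) (normSq_pos.2 (sub_ofReal_ne_zero hv.ne' x))
  have hg : Continuous fun x : ℝ => (x - d) * (x - c) / (normSq (w - x) * normSq (v - x)) :=
    Continuous.div (by fun_prop) ((continuous_normSq.comp (by fun_prop)).mul
      (continuous_normSq.comp (by fun_prop))) fun x => (hN x).ne'
  obtain ⟨y, hy, hyd⟩ := h.exists_support_notMem hcd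
  have hout : ∀ x, x ∉ Icc d c → 0 < (x - d) * (x - c) := by
    intro x hx
    rcases lt_or_ge x d with h2 | h2
    · exact mul_pos_of_neg_of_neg (by linarith) (by linarith)
    · have h3 : c < x := not_le.1 fun h3 => hx ⟨h2, h3⟩
      exact mul_pos (by linarith) (by linarith)
  have hpos : 0 < signedInt μ d c
      (fun x => (x - d) * (x - c) / (normSq (w - x) * normSq (v - x))) := by
    refine h.signedInt_pos hdc hg ?_ ?_ hy hyd (div_pos (hout y hyd) (hN y))
    · exact fun x hx => div_nonpos_of_nonpos_of_nonneg
        (mul_nonpos_of_nonneg_of_nonpos (by linarith [hx.1]) (by linarith [hx.2])) (hN x).le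
    · intro x _ hx
      refine div_nonneg ?_ (hN x).le
      by_cases hx' : x ∈ Icc d c
      · have h2 : x ≤ d := not_lt.1 fun h2 => hx ⟨h2, hx'.2⟩
        exact mul_nonneg_of_nonpos_of_nonpos (by linarith) (by linarith)
      · exact (hout x hx').le
  have hne : ∀ z u : ℂ, 0 < z.im → 0 < u.im → z - star u ≠ 0 := fun z u hz hu h2 => by
    have h3 := congrArg Complex.im h2
    simp at h3
    linarith
  have hf : ∀ S k : ℂ, Continuous fun x : ℝ =>
      S * (1 / ((w - (x : ℂ)) * (v - x))) + -k * (1 / (v - (x : ℂ))) := fun S k =>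
    ((continuous_resolvent_mul hw.ne' hv.ne').const_mul S).add
      ((continuous_resolvent hv.ne').const_mul (-k))
  -- On the real line `w̄ - x` is the conjugate of `w - x`, so the second half of
  -- `partial_fractions` is the conjugate of the first, and `h0`, `h1` annihilate both.
  obtain ⟨S, k, hSk⟩ : ∃ S k : ℂ, ∀ x : ℝ,
      (((x - d) * (x - c) / (normSq (w - x) * normSq (v - x)) : ℝ) : ℂ) =
      (S * (1 / ((w - (x : ℂ)) * (v - x))) + -k * (1 / (v - (x : ℂ)))) +
        star (S * (1 / ((w - (x : ℂ)) * (v - x))) + -k * (1 / (v - (x : ℂ)))) := by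
    refine ⟨(w - d) * (w - c) / ((w - star w) * (w - star v)),
      (v * w * (d + c - (star w + star v)) + (star w * star v - d * c) * (v + w) +
        (d * c * (star w + star v) - (d + c) * (star w * star v))) /
        ((w - star w) * (w - star v) * ((v - star w) * (v - star v))), fun x => ?_⟩
    have hx : ∀ z : ℂ, 0 < z.im → star z - (x : ℂ) ≠ 0 := fun z hz =>
      sub_ofReal_ne_zero (by simpa using hz.ne') x
    have h2 := partial_fractions (d : ℂ) c (hne w w hw hw) (hne w v hw hv) (hne v w hv hw)
      (hne v v hv hv) (sub_ofReal_ne_zero hw.ne' x) (sub_ofReal_ne_zero hv.ne' x)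
      (hx w hw) (hx v hv)
    push_cast
    rw [← mul_conj, ← mul_conj]
    simp only [star_def, map_sub, conj_ofReal] at h2 ⊢
    rw [h2]
    simp only [map_add, map_mul, map_div₀, map_neg, map_sub, map_one, conj_ofReal, conj_conj]
  have h2 : ((signedInt μ d c
      (fun x => (x - d) * (x - c) / (normSq (w - x) * normSq (v - x))) : ℝ) : ℂ) = 0 := by
    rw [← signedInt_ofReal, funext hSk, h.signedInt_add d c (hf S k) (hf S k).star, signedInt_conj,
      h.signedInt_linear_combination d c _ _ (continuous_resolvent_mul hw.ne' hv.ne')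
      (continuous_resolvent hv.ne'), h0, h1]
    simp
  exact hpos.ne' (by exact_mod_cast h2)

/-! ### The explicit inverse map -/

theorem isOpen_upperHalf : IsOpen upperHalf := isOpen_lt continuous_const continuous_im

theorem IsDominated.im_exp_C_neg [IsProbabilityMeasure μ] (h : IsDominated μ a b) {w : ℂ}
    (hw : w ∈ upperHalf) : (exp (C μ a b w)).im < 0 := by
  rw [exp_im]
  exact mul_neg_of_pos_of_neg (Real.exp_pos _)
    (Real.sin_neg_of_neg_of_neg_pi_lt (h.im_C_neg hw) (h.neg_pi_lt_im_C hw))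

theorem IsDominated.exp_C_star (h : IsDominated μ a b) (w : ℂ) :
    exp (C μ a b (star w)) = star (exp (C μ a b w)) := by
  rw [h.C_star]
  exact exp_conj _

theorem sub_star_ne_zero {z : ℂ} (hz : z.im ≠ 0) : z - star z ≠ 0 := fun h => by
  have := congrArg Complex.im h
  simp at this
  exact hz this

theorem IsDominated.im_chiExpr [IsProbabilityMeasure μ] (h : IsDominated μ a b) {w : ℂ}
    (hw : w ∈ upperHalf) : (chiExpr μ a b w).im = 0 := by
  have hE := sub_star_ne_zero (h.im_exp_C_neg hw).ne
  have hE' : star (exp (C μ a b w)) - exp (C μ a b w) ≠ 0 := by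
    rw [← neg_sub]
    exact neg_ne_zero.2 hE
  rw [← conj_eq_iff_im, chiExpr, h.exp_C_star]
  simp only [star_def, map_add, map_mul, map_div₀, map_sub, map_one, conj_conj] at hE hE' ⊢
  rw [← neg_sub (exp (C μ a b w))]
  field_simp
  ring

theorem IsDominated.im_etaExpr [IsProbabilityMeasure μ] (h : IsDominated μ a b) {w : ℂ}
    (hw : w ∈ upperHalf) : (etaExpr μ a b w).im = 0 := by
  have hE := sub_star_ne_zero (h.im_exp_C_neg hw).ne
  rw [← conj_eq_iff_im, etaExpr, h.exp_C_star]
  simp only [star_def, map_add, map_mul, map_div₀, map_sub, map_one, conj_conj] at hE ⊢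
  rw [← neg_sub (exp (C μ a b w))]
  field_simp
  ring

/-- The defining linear equation of `(χ, η)` in terms of `w`. -/
theorem IsDominated.exp_C_mul_sub_chiEta [IsProbabilityMeasure μ] (h : IsDominated μ a b) {w : ℂ}
    (hw : w ∈ upperHalf) : exp (C μ a b w) * (w - ((chiEta μ a b w).1 : ℂ)) =
      w - (((chiEta μ a b w).1 + (chiEta μ a b w).2 - 1 : ℝ) : ℂ) := by
  have h1 : (((chiEta μ a b w).1 : ℝ) : ℂ) = chiExpr μ a b w :=
    Complex.ext rfl (h.im_chiExpr hw).symm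
  have h2 : (((chiEta μ a b w).2 : ℝ) : ℂ) = etaExpr μ a b w :=
    Complex.ext rfl (h.im_etaExpr hw).symm
  have hE := sub_star_ne_zero (h.im_exp_C_neg hw).ne
  push_cast
  rw [h1, h2, chiExpr, etaExpr, h.exp_C_star]
  field_simp
  ring

/-- Since `e^C` is not real, `1` and `e^C` are independent over the reals, so the difference of two
solutions vanishes. -/
theorem IsDominated.eq_chiEta [IsProbabilityMeasure μ] (h : IsDominated μ a b) {w : ℂ}
    (hw : w ∈ upperHalf) {p : ℝ × ℝ}
    (hp : exp (C μ a b w) * (w - (p.1 : ℂ)) = w - ((p.1 + p.2 - 1 : ℝ) : ℂ)) :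
    p = chiEta μ a b w := by
  have h1 := h.exp_C_mul_sub_chiEta hw
  set q := chiEta μ a b w
  have hE := h.im_exp_C_neg hw
  have h2 : exp (C μ a b w) * ((p.1 - q.1 : ℝ) : ℂ) =
      ((p.1 + p.2 - 1 - (q.1 + q.2 - 1) : ℝ) : ℂ) := by
    push_cast at *
    linear_combination h1 - hp
  have h3 := congrArg Complex.im h2
  rw [im_mul_ofReal, ofReal_im] at h3
  have h4 : p.1 - q.1 = 0 := (mul_eq_zero.1 h3).resolve_left hE.ne
  rw [h4, ofReal_zero, mul_zero, eq_comm, ofReal_eq_zero] at h2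
  exact Prod.ext (by linarith) (by linarith)

theorem fPrime_exp (p : ℝ × ℝ) {w : ℂ} (hw : w.im ≠ 0) :
    exp (fPrime μ a b p w) = exp (C μ a b w) * (w - (p.1 : ℂ)) /
      (w - ((p.1 + p.2 - 1 : ℝ) : ℂ)) := by
  have h1 : w - (p.1 : ℂ) - p.2 + 1 = w - ((p.1 + p.2 - 1 : ℝ) : ℂ) := by
    push_cast
    ring
  rw [fPrime, h1, exp_sub, exp_add, exp_log (sub_ofReal_ne_zero hw _),
    exp_log (sub_ofReal_ne_zero hw _)]

theorem IsDominated.fPrime_eq_zero_iff [IsProbabilityMeasure μ] (h : IsDominated μ a b) {w : ℂ}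
    (hw : w ∈ upperHalf) (p : ℝ × ℝ) : fPrime μ a b p w = 0 ↔ p = chiEta μ a b w := by
  have hw' : 0 < w.im := hw
  have hne := sub_ofReal_ne_zero hw'.ne' (p.1 + p.2 - 1)
  constructor
  · intro h0
    have h1 := fPrime_exp (μ := μ) (a := a) (b := b) p hw'.ne'
    rw [h0, exp_zero, eq_div_iff hne, one_mul] at h1
    exact h.eq_chiEta hw h1.symm
  · rintro rfl
    have h1 := fPrime_exp (μ := μ) (a := a) (b := b) (chiEta μ a b w) hw'.ne'
    rw [h.exp_C_mul_sub_chiEta hw, div_self hne, exp_eq_one_iff] at h1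
    obtain ⟨n, hn⟩ := h1
    have harg : ∀ x : ℝ, 0 ≤ arg (w - x) ∧ arg (w - x) < Real.pi := fun x =>
      ⟨arg_nonneg_iff.2 (by simpa using hw'.le),
        arg_lt_pi_iff.2 (Or.inr (by simpa using hw'.ne'))⟩
    have him := congrArg Complex.im hn
    have h2 : w - ((chiEta μ a b w).1 : ℂ) - ((chiEta μ a b w).2 : ℂ) + 1 =
        w - (((chiEta μ a b w).1 + (chiEta μ a b w).2 - 1 : ℝ) : ℂ) := by
      push_cast
      ring
    rw [fPrime, h2, sub_im, add_im, log_im, log_im] at him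
    have hr : ((n : ℂ) * (2 * (Real.pi : ℂ) * I)).im = n * (2 * Real.pi) := by simp
    rw [hr] at him
    have hpi := Real.pi_pos
    have h3 := harg (chiEta μ a b w).1
    have h4 := harg ((chiEta μ a b w).1 + (chiEta μ a b w).2 - 1)
    have h5 := h.im_C_neg hw'
    have h6 := h.neg_pi_lt_im_C hw'
    -- `Im f'` lies strictly between `-2π` and `π`: `Im C` is in `(-π, 0)` and both arguments are in
    -- `[0, π)`.
    have h7 : (n : ℝ) < 1 := by nlinarith
    have h8 : (-1 : ℝ) < n := by nlinarith
    have h9 : n = 0 := by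
      have : n < 1 := by exact_mod_cast h7
      have : -1 < n := by exact_mod_cast h8
      omega
    rw [hn, h9, Int.cast_zero, zero_mul]

/-- Multiplying the linear equation by the conjugate of `w - χ` and taking imaginary parts gives `Im
(e^C) |w - χ|² = Im w (η - 1)`, whose left side is negative. This supplies the `d ≤ c` that
`bounds_of_zero` needs. -/
theorem IsDominated.chiEta_snd_le_one [IsProbabilityMeasure μ] (h : IsDominated μ a b) {w : ℂ}
    (hw : w ∈ upperHalf) : (chiEta μ a b w).2 ≤ 1 := by
  have hw' : 0 < w.im := hw
  have h1 := h.exp_C_mul_sub_chiEta hw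
  set q := chiEta μ a b w
  have hN := normSq_pos.2 (sub_ofReal_ne_zero hw'.ne' q.1)
  have h2 : exp (C μ a b w) * (normSq (w - q.1) : ℂ) =
      (w - ((q.1 + q.2 - 1 : ℝ) : ℂ)) * (starRingEnd ℂ) (w - q.1) := by
    rw [← h1, ← mul_conj]
    ring
  have h3 := congrArg Complex.im h2
  rw [im_mul_ofReal] at h3
  have h4 : ((w - ((q.1 + q.2 - 1 : ℝ) : ℂ)) * (starRingEnd ℂ) (w - q.1)).im =
      w.im * (q.2 - 1) := by
    simp
    ring
  have h5 := mul_neg_of_neg_of_pos (h.im_exp_C_neg hw) hN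
  rw [h3, h4] at h5
  nlinarith

theorem IsDominated.chiEta_mem_liquid [IsProbabilityMeasure μ] (h : IsDominated μ a b) {w : ℂ}
    (hw : w ∈ upperHalf) : chiEta μ a b w ∈ liquid μ a b := by
  have hw' : 0 < w.im := hw
  have h0 : fPrime μ a b (chiEta μ a b w) w = 0 := (h.fPrime_eq_zero_iff hw _).2 rfl
  have h1 := h.chiEta_snd_le_one hw
  have h2 := h0
  rw [h.fPrime_eq _ hw'.ne'] at h2
  obtain ⟨h3, h4, h5⟩ := h.bounds_of_zero (by linarith) hw'.ne' h2
  exact ⟨⟨⟨by linarith, h5⟩, ⟨by linarith, h1⟩, h5, by linarith, h4⟩, w, hw'.ne', h0⟩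

/-! ### Uniqueness of the root and the bijection -/

theorem IsDominated.root_unique [IsProbabilityMeasure μ] (h : IsDominated μ a b) {p : ℝ × ℝ}
    (hp : p ∈ shape a b) {w v : ℂ} (hw : w ∈ upperHalf) (hv : v ∈ upperHalf)
    (hpw : fPrime μ a b p w = 0) (hpv : fPrime μ a b p v = 0) : w = v := by
  have hw' : 0 < w.im := hw
  have hv' : 0 < v.im := hv
  by_contra hne
  rw [h.fPrime_eq p hw'.ne'] at hpw
  rw [h.fPrime_eq p hv'.ne'] at hpv
  obtain ⟨-, ⟨h1, h2⟩, -⟩ := hp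
  refine h.signedInt_mul_ne_zero (d := p.1 + p.2 - 1) (c := p.1) (by linarith) (by linarith)
    hw' hv' hpv ?_
  -- The product of resolvents is a difference quotient of resolvents, so two distinct roots
  -- annihilate it.
  have h3 : (fun x : ℝ => 1 / ((w - (x : ℂ)) * (v - x))) =
      fun x : ℝ => (1 / (v - w)) * (1 / (w - (x : ℂ))) + (-(1 / (v - w))) * (1 / (v - (x : ℂ))) := by
    funext x
    have h4 := sub_ofReal_ne_zero hw'.ne' x
    have h5 := sub_ofReal_ne_zero hv'.ne' x
    have h6 : v - w ≠ 0 := sub_ne_zero.2 (Ne.symm hne)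
    field_simp
    ring
  rw [h3, h.signedInt_linear_combination _ _ _ _ (continuous_resolvent hw'.ne')
    (continuous_resolvent hv'.ne'), hpw, hpv, mul_zero, mul_zero, add_zero]

theorem IsDominated.fPrime_star [IsProbabilityMeasure μ] (h : IsDominated μ a b) (p : ℝ × ℝ)
    {w : ℂ} (hw : w.im ≠ 0) : fPrime μ a b p (star w) = star (fPrime μ a b p w) := by
  rw [h.fPrime_eq p hw, h.fPrime_eq p (by simpa using hw), ← signedInt_conj]
  simp

theorem IsDominated.exists_root [IsProbabilityMeasure μ] (h : IsDominated μ a b) {p : ℝ × ℝ}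
    (hp : p ∈ liquid μ a b) : ∃ w : ℂ, w ∈ upperHalf ∧ fPrime μ a b p w = 0 := by
  obtain ⟨-, w, hw, h0⟩ := hp
  rcases lt_or_gt_of_ne hw with h1 | h1
  · refine ⟨star w, ?_, ?_⟩
    · simpa [upperHalf] using h1
    · rw [h.fPrime_star p hw, h0, star_zero]
  · exact ⟨w, h1, h0⟩

theorem IsDominated.W_spec [IsProbabilityMeasure μ] (h : IsDominated μ a b) {p : ℝ × ℝ}
    (hp : p ∈ liquid μ a b) : W μ a b p ∈ upperHalf ∧ fPrime μ a b p (W μ a b p) = 0 :=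
  Classical.epsilon_spec (h.exists_root hp)

theorem IsDominated.chiEta_W [IsProbabilityMeasure μ] (h : IsDominated μ a b) {p : ℝ × ℝ}
    (hp : p ∈ liquid μ a b) : chiEta μ a b (W μ a b p) = p :=
  ((h.fPrime_eq_zero_iff (h.W_spec hp).1 p).1 (h.W_spec hp).2).symm

theorem IsDominated.W_chiEta [IsProbabilityMeasure μ] (h : IsDominated μ a b) {w : ℂ}
    (hw : w ∈ upperHalf) : W μ a b (chiEta μ a b w) = w :=
  have hp := h.chiEta_mem_liquid hw
  h.root_unique hp.1 (h.W_spec hp).1 hw (h.W_spec hp).2 ((h.fPrime_eq_zero_iff hw _).2 rfl)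

/-! ### Smoothness and the inverse function theorem -/

theorem IsDominated.hasDerivAt_C [IsProbabilityMeasure μ] (h : IsDominated μ a b) {w : ℂ}
    (hw : w ∈ upperHalf) :
    HasDerivAt (C μ a b) (-∫ x, 1 / ((w - (x : ℂ)) * (w - x)) ∂μ) w := by
  have hw' : 0 < w.im := hw
  have hs : {z : ℂ | w.im / 2 < z.im} ∈ 𝓝 w :=
    (isOpen_lt continuous_const continuous_im).mem_nhds (by
      change w.im / 2 < w.im
      linarith)
  have hpos : ∀ z ∈ {z : ℂ | w.im / 2 < z.im}, 0 < z.im := fun z hz => by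
    have : w.im / 2 < z.im := hz
    linarith
  rw [show C μ a b = fun z => ∫ x, 1 / (z - (x : ℂ)) ∂μ from funext h.C_eq, ← integral_neg]
  refine (hasDerivAt_integral_of_dominated_loc_of_deriv_le (μ := μ) (𝕜 := ℂ) (E := ℂ)
    (F := fun z (x : ℝ) => 1 / (z - (x : ℂ)))
    (F' := fun z (x : ℝ) => -(1 / ((z - (x : ℂ)) * (z - x))))
    (bound := fun _ => 1 / (w.im / 2 * (w.im / 2))) hs ?_
    (h.integrable (continuous_resolvent hw'.ne'))
    (continuous_resolvent_mul hw'.ne' hw'.ne').neg.aestronglyMeasurable ?_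
    (integrable_const _) ?_).2
  · filter_upwards [hs] with z hz
    exact (continuous_resolvent (hpos z hz).ne').aestronglyMeasurable
  · refine ae_of_all _ fun x z hz => ?_
    have h1 : w.im / 2 ≤ ‖z - (x : ℂ)‖ := by
      have h2 := abs_im_le_norm (z - x)
      have h3 : w.im / 2 < z.im := hz
      rw [sub_im, ofReal_im, sub_zero, abs_of_pos (hpos z hz)] at h2
      linarith
    rw [norm_neg, norm_div, norm_mul, norm_one]
    gcongr
  · refine ae_of_all _ fun x z hz => ?_
    have h1 := sub_ofReal_ne_zero (hpos z hz).ne' x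
    have h2 := ((hasDerivAt_id z).sub_const (x : ℂ)).inv h1
    simp only [one_div]
    exact h2.congr_deriv (by simp only [id]; field_simp)

theorem integral_resolvent_sq {w : ℂ} (hw : w.im ≠ 0) (d c : ℝ) :
    ∫ x in d..c, 1 / ((w - (x : ℂ)) * (w - x)) = 1 / (w - c) - 1 / (w - d) := by
  have h1 : ∀ x ∈ uIcc d c, HasDerivAt (fun x : ℝ => (w - (x : ℂ))⁻¹)
      (1 / ((w - (x : ℂ)) * (w - x))) x := by
    intro x _
    have h2 : HasDerivAt (fun x : ℝ => w - (x : ℂ)) (-1) x := by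
      simpa using (hasDerivAt_id x).ofReal_comp.const_sub w
    have h4 := sub_ofReal_ne_zero hw x
    exact (h2.inv h4).congr_deriv (by field_simp)
  rw [intervalIntegral.integral_eq_sub_of_hasDerivAt h1
    ((continuous_resolvent_mul hw hw).intervalIntegrable _ _), one_div, one_div]

theorem IsDominated.contDiffOn_chiEta [IsProbabilityMeasure μ] (h : IsDominated μ a b) :
    ContDiffOn ℝ ∞ (chiEta μ a b) upperHalf := by
  have hC : ContDiffOn ℝ ∞ (fun w => exp (C μ a b w)) upperHalf := by
    have h1 : DifferentiableOn ℂ (fun w => exp (C μ a b w)) upperHalf := fun w hw =>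
      (h.hasDerivAt_C hw).cexp.differentiableAt.differentiableWithinAt
    exact (h1.contDiffOn isOpen_upperHalf).restrict_scalars ℝ
  have hstar : ContDiff ℝ ∞ (fun w : ℂ => star w) := conjCLE.contDiff
  have hC' : ContDiffOn ℝ ∞ (fun w => exp (C μ a b (star w))) upperHalf := by
    simp only [h.exp_C_star]
    exact hstar.comp_contDiffOn hC
  have hid : ContDiffOn ℝ ∞ (fun w : ℂ => w - star w) upperHalf :=
    (contDiff_id.sub hstar).contDiffOn
  have hne : ∀ w ∈ upperHalf, exp (C μ a b w) - exp (C μ a b (star w)) ≠ 0 := fun w hw => by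
    rw [h.exp_C_star]
    exact sub_star_ne_zero (h.im_exp_C_neg hw).ne
  have hinv := (hC.sub hC').inv hne
  have h1 : ContDiffOn ℝ ∞ (chiExpr μ a b) upperHalf :=
    (contDiffOn_id.add ((hid.mul (hC'.sub (contDiffOn_const (c := (1 : ℂ))))).mul hinv)).congr
      fun w _ => by simp only [chiExpr, div_eq_mul_inv, id, Pi.inv_apply]
  have h2 : ContDiffOn ℝ ∞ (etaExpr μ a b) upperHalf :=
    ((contDiffOn_const (c := (1 : ℂ))).add (((hid.mul (hC.sub (contDiffOn_const (c := (1 : ℂ))))).mul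
      (hC'.sub (contDiffOn_const (c := (1 : ℂ))))).mul hinv)).congr
      fun w _ => by simp only [etaExpr, div_eq_mul_inv, Pi.inv_apply]
  exact (reCLM.contDiff.comp_contDiffOn h1).prodMk (reCLM.contDiff.comp_contDiffOn h2)

/-- Moving `w` along a kernel vector `v` keeps `(χ, η)` fixed to first order. Differentiating the
linear equation along this line then makes `w` a double root of `f'` unless `v = 0`. -/
theorem IsDominated.fderiv_chiEta_injective [IsProbabilityMeasure μ] (h : IsDominated μ a b)
    {w : ℂ} (hw : w ∈ upperHalf) {D : ℂ →L[ℝ] ℝ × ℝ} (hD : HasFDerivAt (chiEta μ a b) D w) :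
    Function.Injective D := by
  refine (injective_iff_map_eq_zero D).2 fun v hv => ?_
  have hw' : 0 < w.im := hw
  have hγ : HasDerivAt (fun t : ℝ => w + t * v) v 0 := by
    simpa using ((hasDerivAt_id (0 : ℝ)).ofReal_comp.mul_const v).const_add w
  have hγ0 : w + ((0 : ℝ) : ℂ) * v = w := by simp
  have hp : HasDerivAt (fun t : ℝ => chiEta μ a b (w + t * v)) 0 0 := by
    rw [← hv]
    exact HasFDerivAt.comp_hasDerivAt (0 : ℝ) (by rwa [hγ0]) hγ
  have hE : HasDerivAt (fun t : ℝ => exp (C μ a b (w + t * v)))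
      (exp (C μ a b w) * -(∫ x, 1 / ((w - (x : ℂ)) * (w - x)) ∂μ) * v) 0 := by
    exact HasDerivAt.comp_of_eq (h₂ := fun z => exp (C μ a b z)) (0 : ℝ) (h.hasDerivAt_C hw).cexp hγ hγ0.symm
  have h1 : HasDerivAt (fun t : ℝ => (((chiEta μ a b (w + t * v)).1 : ℝ) : ℂ)) 0 0 := by
    have := (hasFDerivAt_fst.comp_hasDerivAt (0 : ℝ) hp).ofReal_comp
    simpa using this
  have h2 : HasDerivAt (fun t : ℝ => (((chiEta μ a b (w + t * v)).1 +
      (chiEta μ a b (w + t * v)).2 - 1 : ℝ) : ℂ)) 0 0 := by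
    have h3 := hasFDerivAt_fst.comp_hasDerivAt (0 : ℝ) hp
    have h4 := hasFDerivAt_snd.comp_hasDerivAt (0 : ℝ) hp
    have h5 := ((h3.add h4).sub_const 1).ofReal_comp
    simpa using h5
  have hL := hE.mul (hγ.sub h1)
  have hR := hγ.sub h2
  have heq : (fun t : ℝ => exp (C μ a b (w + t * v)) *
      (w + t * v - (((chiEta μ a b (w + t * v)).1 : ℝ) : ℂ))) =ᶠ[𝓝 0]
      fun t : ℝ => w + t * v - (((chiEta μ a b (w + t * v)).1 +
        (chiEta μ a b (w + t * v)).2 - 1 : ℝ) : ℂ) := by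
    have h3 : ∀ᶠ t : ℝ in 𝓝 0, w + t * v ∈ upperHalf :=
      hγ.continuousAt.eventually_mem (isOpen_upperHalf.mem_nhds (by rwa [hγ0]))
    filter_upwards [h3] with t ht using h.exp_C_mul_sub_chiEta ht
  have hder := (hL.congr_of_eventuallyEq heq.symm).unique hR
  have hcd := h.exp_C_mul_sub_chiEta hw
  have hmem := (h.chiEta_mem_liquid hw).1
  have hroot : fPrime μ a b (chiEta μ a b w) w = 0 := (h.fPrime_eq_zero_iff hw _).2 rfl
  rw [h.fPrime_eq _ hw'.ne'] at hroot
  simp only [Pi.sub_apply, hγ0] at hder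
  set c := (chiEta μ a b w).1
  set d := (chiEta μ a b w).1 + (chiEta μ a b w).2 - 1
  by_contra hv0
  obtain ⟨-, ⟨h5, h6⟩, -⟩ := hmem
  refine h.signedInt_mul_ne_zero (d := d) (c := c) (by simp only [c, d]; linarith)
    (by simp only [c, d]; linarith) hw' hw' hroot ?_
  have hc0 := sub_ofReal_ne_zero hw'.ne' c
  have hd0 := sub_ofReal_ne_zero hw'.ne' d
  rw [signedInt, integral_resolvent_sq hw'.ne']
  set J := ∫ x, 1 / ((w - (x : ℂ)) * (w - x)) ∂μ
  -- Eliminating `e^C` turns the differentiated equation into `v` times the vanishing of the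
  -- integral of `1 / (w - x)²` against the signed measure.
  have hEq : exp (C μ a b w) = (w - d) / (w - c) := by rw [eq_div_iff hc0, hcd]
  rw [hEq] at hder
  field_simp at hder ⊢
  refine mul_right_cancel₀ hv0 ?_
  linear_combination -hder

theorem IsDominated.exists_equiv_hasFDerivAt [IsProbabilityMeasure μ] (h : IsDominated μ a b)
    {w : ℂ} (hw : w ∈ upperHalf) :
    ∃ e : ℂ ≃L[ℝ] ℝ × ℝ, HasFDerivAt (chiEta μ a b) (e : ℂ →L[ℝ] ℝ × ℝ) w := by
  have h1 := ((h.contDiffOn_chiEta.contDiffAt (isOpen_upperHalf.mem_nhds hw)).differentiableAt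
    (by simp)).hasFDerivAt
  have h2 := h.fderiv_chiEta_injective hw h1
  refine ⟨(LinearMap.linearEquivOfInjective
    (fderiv ℝ (chiEta μ a b) w : ℂ →ₗ[ℝ] ℝ × ℝ) h2 (by simp)).toContinuousLinearEquiv,
    h1.congr_fderiv (ContinuousLinearMap.ext fun _ => rfl)⟩

theorem IsDominated.liquid_mem_nhds_and_contDiffAt_W [IsProbabilityMeasure μ]
    (h : IsDominated μ a b) {w : ℂ} (hw : w ∈ upperHalf) :
    liquid μ a b ∈ 𝓝 (chiEta μ a b w) ∧ ContDiffAt ℝ ∞ (W μ a b) (chiEta μ a b w) := by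
  obtain ⟨e, he⟩ := h.exists_equiv_hasFDerivAt hw
  have hf := h.contDiffOn_chiEta.contDiffAt (isOpen_upperHalf.mem_nhds hw)
  have hs := hf.hasStrictFDerivAt' he (by simp)
  constructor
  · rw [← hs.map_nhds_eq_of_equiv]
    exact mem_map.2 (mem_of_superset (isOpen_upperHalf.mem_nhds hw)
      fun z hz => h.chiEta_mem_liquid hz)
  · have hg := hf.to_localInverse he (by simp)
    -- Near the base point the local inverse stays in the upper half-plane, where uniqueness of the
    -- root identifies it with `W`.
    refine hg.congr_of_eventuallyEq ?_
    have h1 : ∀ᶠ p in 𝓝 (chiEta μ a b w), hf.localInverse he (by simp) p ∈ upperHalf :=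
      hg.continuousAt.eventually_mem (isOpen_upperHalf.mem_nhds (by
        rwa [hf.localInverse_apply_image he (by simp)]))
    filter_upwards [h1, hs.eventually_right_inverse] with p hp hp'
    have h2 := h.W_chiEta hp
    rwa [show chiEta μ a b (hf.localInverse he (by simp) p) = p from hp'] at h2

end GTLiquid

theorem mainTheorem11 (x : (n : ℕ) → Fin n → ℤ) (μ : Measure ℝ) [IsProbabilityMeasure μ]
    (a b : ℝ) (h : GTLiquid.Hyp x μ a b) :
    IsOpen (GTLiquid.liquid μ a b) ∧
    (∀ p ∈ GTLiquid.liquid μ a b,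
      ∃! w : ℂ, w ∈ GTLiquid.upperHalf ∧ GTLiquid.fPrime μ a b p w = 0) ∧
    (∀ w ∈ GTLiquid.upperHalf,
      (GTLiquid.chiExpr μ a b w).im = 0 ∧ (GTLiquid.etaExpr μ a b w).im = 0) ∧
    Set.BijOn (GTLiquid.W μ a b) (GTLiquid.liquid μ a b) GTLiquid.upperHalf ∧
    Set.BijOn (GTLiquid.chiEta μ a b) GTLiquid.upperHalf (GTLiquid.liquid μ a b) ∧
    Set.InvOn (GTLiquid.chiEta μ a b) (GTLiquid.W μ a b)
      (GTLiquid.liquid μ a b) GTLiquid.upperHalf ∧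
    ContDiffOn ℝ ∞ (GTLiquid.W μ a b) (GTLiquid.liquid μ a b) ∧
    ContDiffOn ℝ ∞ (GTLiquid.chiEta μ a b) GTLiquid.upperHalf := by
  have hd := h.isDominated
  have hinv : Set.InvOn (GTLiquid.chiEta μ a b) (GTLiquid.W μ a b)
      (GTLiquid.liquid μ a b) GTLiquid.upperHalf :=
    ⟨fun _ hp => hd.chiEta_W hp, fun _ hw => hd.W_chiEta hw⟩
  have hmapsW : Set.MapsTo (GTLiquid.W μ a b) (GTLiquid.liquid μ a b) GTLiquid.upperHalf :=
    fun _ hp => (hd.W_spec hp).1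
  have hmaps : Set.MapsTo (GTLiquid.chiEta μ a b) GTLiquid.upperHalf (GTLiquid.liquid μ a b) :=
    fun _ hw => hd.chiEta_mem_liquid hw
  have hloc : ∀ p ∈ GTLiquid.liquid μ a b,
      GTLiquid.liquid μ a b ∈ 𝓝 p ∧ ContDiffAt ℝ ∞ (GTLiquid.W μ a b) p := fun p hp => by
    simpa only [hd.chiEta_W hp] using hd.liquid_mem_nhds_and_contDiffAt_W (hd.W_spec hp).1
  refine ⟨isOpen_iff_mem_nhds.2 fun p hp => (hloc p hp).1, fun p hp => ?_,
    fun w hw => ⟨hd.im_chiExpr hw, hd.im_etaExpr hw⟩, hinv.bijOn hmapsW hmaps,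
    hinv.symm.bijOn hmaps hmapsW, hinv, fun p hp => (hloc p hp).2.contDiffWithinAt,
    hd.contDiffOn_chiEta⟩
  exact ⟨_, hd.W_spec hp, fun v hv => hd.root_unique hp.1 hv.1 (hd.W_spec hp).1 hv.2
    (hd.W_spec hp).2⟩
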